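/- Let $\mathbf k$ be a field of characteristic zero and $\mathfrak g=\bigoplus_{k\in\mathbb Z}\mathfrak g^k$ a $\mathbb Z$-graded vector space. Let $\mathrm{Sym}^n(\mathfrak g)$ be the graded symmetric powers. For homogeneous $x_1,\dots,x_n$ and $\sigma\in\mathbb S_n$, let $\varepsilon(\sigma)$ be the Koszul sign, defined by $x_1\cdots x_n=\varepsilon(\sigma)\,x_{\sigma(1)}\cdots x_{\sigma(n)}$; in exponents of $-1$ write $x$ for the degree of $x$. Let $\mathbb S_{(i_1,\dots,i_r)}$ be the set of $(i_1,\dots,i_r)$-shuffles, i.e. permutations of $i_1+\dots+i_r$ symbols that increase on each of the consecutive blocks of lengths $i_1,\dots,i_r$. *Definitions.* (a) An $L_\infty$-algebra $(\mathfrak g,\{l_k\}_{k\ge1})$ consists of graded symmetric linear maps $l_k:\mathfrak g^{\otimes k}\to\mathfrak g$ of degree $1$ (that is, $l_k(x_{\sigma(1)},\dots,x_{\sigma(k)})=\varepsilon(\sigma)l_k(x_1,\dots,x_k)$) such that, for all $n\ge 0$ and homogeneous $x_1,\dots,x_n$, $$\sum_{i=1}^n\sum_{\sigma\in\mathbb S_{(i,n-i)}}\varepsilon(\sigma)\,l_{n-i+1}\big(l_i(x_{\sigma(1)},\dots,x_{\sigma(i)}),x_{\sigma(i+1)},\dots,x_{\sigma(n)}\big)=0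 .$$ (b) A post-Lie$_\infty$ algebra $(\mathfrak g,\{M_{p,q}\}_{p\ge0,q\ge1})$ consists of linear maps $M_{p,q}:\mathrm{Sym}^p(\mathfrak g)\otimes\mathrm{Sym}^q(\mathfrak g)\to\mathfrak g$ of degree $1$ such that, for all $n\ge0$, $m\ge1$ and homogeneous $x_1,\dots,x_{n+m}$, $$\sum_{\substack{0\le j\le n-1,\ 1\le i\le n-j\\ \sigma\in\mathbb S_{(j,i,n-j-i)}}}\varepsilon(\sigma)\,M_{n-j-i+1,m}\Big(M_{j,i}(x_{\sigma(1)}\cdots x_{\sigma(j)}\otimes x_{\sigma(j+1)}\cdots x_{\sigma(j+i)})\,x_{\sigma(j+i+1)}\cdots x_{\sigma(n)}\otimes x_{n+1}\cdots x_{n+m}\Big)$$ $$+\sum_{\substack{0\le j\le n\\ \sigma\in\mathbb S_{(n-j,j)}}}\ \sum_{\substack{1\le i\le m\\ \tau\in\mathbb S_{(i,m-i)}}}\varepsilon(\sigma)\varepsilon(\tau)(-1)^{x_{\sigma(1)}+\dots+x_{\sigma(n-j)}}\,M_{n-j,m-i+1}\Big(x_{\sigma(1)}\cdots x_{\sigma(n-j)}\otimes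 M_{j,i}(x_{\sigma(n-j+1)}\cdots x_{\sigma(n)}\otimes x_{n+\tau(1)}\cdots x_{n+\tau(i)})\,x_{n+\tau(i+1)}\cdots x_{n+\tau(m)}\Big)=0 .$$ (c) An open-closed homotopy Lie algebra $(\mathfrak g,\mathfrak h,\{l_k\}_{k\ge1},\{R_{p,q}\}_{p+q\ge1})$ consists of an $L_\infty$-algebra $(\mathfrak g,\{l_k\})$, a graded vector space $\mathfrak h$ and linear maps $R_{p,q}:\mathrm{Sym}^p(\mathfrak g)\otimes\mathrm{Sym}^q(\mathfrak h)\to\mathfrak h$ of degree $1$, for $p,q\ge0$ with $p+q\ge1$, such that, for all $n,m\ge 0$ with $n+m\ge1$ and homogeneous $x_1,\dots,x_n\in\mathfrak g$, $u_1,\dots,u_m\in\mathfrak h$, $$\sum_{i=1}^n\sum_{\sigma\in\mathbb S_{(i,n-i)}}\varepsilon(\sigma)\,R_{n-i+1,m}\big(l_i(x_{\sigma(1)},\dots,x_{\sigma(i)})\,x_{\sigma(i+1)}\cdots x_{\sigma(n)}\otimes u_1\cdots u_m\big)$$ $$+\sum_{\substack{0\le i\le n,\ 0\le k\le m\\ (n-i)+k\ge1}}\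 \sum_{\substack{\sigma\in\mathbb S_{(i,n-i)}\\ \tau\in\mathbb S_{(k,m-k)}}}\varepsilon(\sigma)\varepsilon(\tau)(-1)^{x_{\sigma(1)}+\dots+x_{\sigma(i)}}\,R_{i,m-k+1}\Big(x_{\sigma(1)}\cdots x_{\sigma(i)}\otimes R_{n-i,k}(x_{\sigma(i+1)}\cdots x_{\sigma(n)}\otimes u_{\tau(1)}\cdots u_{\tau(k)})\,u_{\tau(k+1)}\cdots u_{\tau(m)}\Big)=0 .$$ **Theorem.** Let $(\mathfrak g,\{M_{p,q}\}_{p\ge0,q\ge1})$ be a post-Lie$_\infty$ algebra. Let $l^C_k:\mathfrak g^{\otimes k}\to\mathfrak g$, $k\ge1$, be the linear maps given on homogeneous $x_1,\dots,x_k\in\mathfrak g$ by $$l^C_k(x_1,\dots,x_k)=\sum_{j=0}^{k-1}\sum_{\sigma\in\mathbb S_{(j,k-j)}}\varepsilon(\sigma)\,M_{j,k-j}\big(x_{\sigma(1)}\cdots x_{\sigma(j)}\otimes x_{\sigma(j+1)}\cdots x_{\sigma(k)}\big).$$ Then $(\mathfrak g,\{l^C_k\}_{k\ge1})$ is an $L_\infty$-algebra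 (the sub-adjacent $L_\infty$-algebra). Moreover, setting $M_{p,0}=0$ for all $p\ge1$, $(\mathfrak g,\mathfrak g,\{l^C_k\}_{k\ge1},\{M_{p,q}\}_{p+q\ge1})$ is an open-closed homotopy Lie algebra. -/

import Mathlib

open scoped TensorProduct

namespace PostLieInfinity

/-! ### Shuffles, Koszul signs, blocks of arguments

Permutations act on `Fin n = {0, …, n-1}`. -/

section Combinatorics

/-- The `(i, n-i)`-shuffles: permutations of `n` symbols that are increasing on the first `i`
positions and on the remaining `n - i` positions. -/
def shuffles₂ (n i : ℕ) : Finset (Equiv.Perm (Fin n)) :=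
  {σ | ∀ a b : Fin n, a < b → ((b : ℕ) < i ∨ i ≤ (a : ℕ)) → σ a < σ b}

/-- The `(j, i, n-j-i)`-shuffles: permutations of `n` symbols that are increasing on the first `j`
positions, on the next `i` positions and on the remaining `n - j - i` positions. -/
def shuffles₃ (n j i : ℕ) : Finset (Equiv.Perm (Fin n)) :=
  {σ | ∀ a b : Fin n, a < b →
    ((b : ℕ) < j ∨ (j ≤ (a : ℕ) ∧ (b : ℕ) < j + i) ∨ j + i ≤ (a : ℕ)) → σ a < σ b}

/-- The Koszul sign `ε(σ; x₁, …, xₙ)` of a permutation of homogeneous elements of degrees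
`d₁, …, dₙ`: the sign in `x₁ ⋯ xₙ = ε(σ) x_{σ(1)} ⋯ x_{σ(n)}`. Every inversion of `σ` exchanges
two elements and contributes the factor `(-1)^{d d'}`. -/
def koszulSign {n : ℕ} (d : Fin n → ℤ) (σ : Equiv.Perm (Fin n)) : ℤˣ :=
  ∏ a : Fin n, ∏ b : Fin n,
    if a < b ∧ σ b < σ a then Int.negOnePow (d (σ a) * d (σ b)) else 1

/-- The block of `l` consecutive entries of `x` that follows the first `s` entries
(only used for `s + l ≤ n`, so that the default value does not occur). -/
def block {n : ℕ} {V : Type*} [Zero V] (x : Fin n → V) (s l : ℕ) : Fin l → V :=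
  fun a => if h : s + (a : ℕ) < n then x ⟨s + a, h⟩ else 0

end Combinatorics

/-! ### Graded symmetric powers

A `ℤ`-graded vector space is a vector space `V` with a decomposition `V = ⨁ k, 𝒱 k`. -/

section GradedSym

variable {K : Type*} [Field K] {V : Type*} [AddCommGroup V] [Module K V]

/-- The relations `x₁ ⊗ ⋯ ⊗ xₙ = ε(σ; x₁, …, xₙ) x_{σ(1)} ⊗ ⋯ ⊗ x_{σ(n)}`, for homogeneous `xᵢ`,
in the tensor power `V^{⊗ n}`. -/
def symRelations (𝒱 : ℤ → Submodule K V) (n : ℕ) :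
    Submodule K (PiTensorProduct K (fun _ : Fin n => V)) :=
  Submodule.span K
    {t | ∃ (d : Fin n → ℤ) (x : Fin n → V) (σ : Equiv.Perm (Fin n)), (∀ a, x a ∈ 𝒱 (d a)) ∧
      t = PiTensorProduct.tprod K x - koszulSign d σ • PiTensorProduct.tprod K (x ∘ σ)}

/-- The graded symmetric power `Symⁿ(V)`. -/
abbrev GSym (𝒱 : ℤ → Submodule K V) (n : ℕ) : Type _ :=
  PiTensorProduct K (fun _ : Fin n => V) ⧸ symRelations 𝒱 n

/-- The product `x₁ x₂ ⋯ xₙ ∈ Symⁿ(V)`, as a multilinear map. -/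
def symProd (𝒱 : ℤ → Submodule K V) (n : ℕ) :
    MultilinearMap K (fun _ : Fin n => V) (GSym 𝒱 n) :=
  (symRelations 𝒱 n).mkQ.compMultilinearMap (PiTensorProduct.tprod K)

end GradedSym

/-! ### `L∞`-algebras, open-closed homotopy Lie algebras, post-Lie`∞` algebras -/

section Structures

variable {K : Type*} [Field K]
  {V : Type*} [AddCommGroup V] [Module K V] (𝒱 : ℤ → Submodule K V)
  {W : Type*} [AddCommGroup W] [Module K W] (𝒲 : ℤ → Submodule K W)

/-- The maps `l k : V^{⊗ k} → V`, `k ≥ 1`, form an `L∞`-algebra structure on the graded vector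
space `V` (all of degree `1`, graded symmetric). The value of `l` at `k = 0` plays no role. -/
structure IsLInfinityAlgebra (l : ∀ k : ℕ, MultilinearMap K (fun _ : Fin k => V) V) : Prop where
  degree_one : ∀ k : ℕ, 1 ≤ k → ∀ (d : Fin k → ℤ) (x : Fin k → V), (∀ a, x a ∈ 𝒱 (d a)) →
    l k x ∈ 𝒱 (∑ a, d a + 1)
  symmetric : ∀ k : ℕ, 1 ≤ k → ∀ (d : Fin k → ℤ) (x : Fin k → V), (∀ a, x a ∈ 𝒱 (d a)) →
    ∀ σ : Equiv.Perm (Fin k), l k (x ∘ σ) = koszulSign d σ • l k x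
  jacobi : ∀ (n : ℕ) (d : Fin n → ℤ) (x : Fin n → V), (∀ a, x a ∈ 𝒱 (d a)) →
    ∑ i ∈ Finset.Icc 1 n, ∑ σ ∈ shuffles₂ n i,
      koszulSign d σ •
        l (n - i + 1) (Fin.cons (l i (block (x ∘ σ) 0 i)) (block (x ∘ σ) i (n - i))) = 0

/-- `(V, W, {l k}_{k ≥ 1}, {R p q}_{p + q ≥ 1})` is an open-closed homotopy Lie algebra.
The map `R 0 0` is not part of the structure: it occurs in no condition. -/
structure IsOpenClosedHomotopyLie (l : ∀ k : ℕ, MultilinearMap K (fun _ : Fin k => V) V)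
    (R : ∀ p q : ℕ, GSym 𝒱 p ⊗[K] GSym 𝒲 q →ₗ[K] W) : Prop where
  isLInfinity : IsLInfinityAlgebra 𝒱 l
  degree_one : ∀ p q : ℕ, 1 ≤ p + q → ∀ (d : Fin p → ℤ) (x : Fin p → V) (e : Fin q → ℤ)
    (u : Fin q → W), (∀ a, x a ∈ 𝒱 (d a)) → (∀ b, u b ∈ 𝒲 (e b)) →
    R p q (symProd 𝒱 p x ⊗ₜ[K] symProd 𝒲 q u) ∈ 𝒲 (∑ a, d a + ∑ b, e b + 1)
  compat : ∀ n m : ℕ, 1 ≤ n + m → ∀ (d : Fin n → ℤ) (x : Fin n → V) (e : Fin m → ℤ)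
    (u : Fin m → W), (∀ a, x a ∈ 𝒱 (d a)) → (∀ b, u b ∈ 𝒲 (e b)) →
    (∑ i ∈ Finset.Icc 1 n, ∑ σ ∈ shuffles₂ n i,
      koszulSign d σ •
        R (n - i + 1) m
          (symProd 𝒱 (n - i + 1)
              (Fin.cons (l i (block (x ∘ σ) 0 i)) (block (x ∘ σ) i (n - i)))
            ⊗ₜ[K] symProd 𝒲 m u))
    + (∑ i ∈ Finset.range (n + 1), ∑ k ∈ (Finset.range (m + 1)).filter (fun k => 1 ≤ (n - i) + k),
        ∑ σ ∈ shuffles₂ n i, ∑ τ ∈ shuffles₂ m k,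
      (koszulSign d σ * koszulSign e τ * Int.negOnePow (∑ a : Fin i, block (d ∘ σ) 0 i a)) •
        R i (m - k + 1)
          (symProd 𝒱 i (block (x ∘ σ) 0 i)
            ⊗ₜ[K] symProd 𝒲 (m - k + 1)
              (Fin.cons
                (R (n - i) k
                  (symProd 𝒱 (n - i) (block (x ∘ σ) i (n - i))
                    ⊗ₜ[K] symProd 𝒲 k (block (u ∘ τ) 0 k)))
                (block (u ∘ τ) k (m - k))))) = 0

/-- The maps `M p q : Symᵖ(V) ⊗ Sym^q(V) → V`, `p ≥ 0`, `q ≥ 1`, form a post-Lie`∞` algebra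
structure on the graded vector space `V`. The maps `M p 0` are not part of the structure: they
occur in no condition. The arguments `x_{n+1}, …, x_{n+m}` are called `y₁, …, yₘ` here. -/
structure IsPostLieInfinity (M : ∀ p q : ℕ, GSym 𝒱 p ⊗[K] GSym 𝒱 q →ₗ[K] V) : Prop where
  degree_one : ∀ p q : ℕ, 1 ≤ q → ∀ (d : Fin p → ℤ) (x : Fin p → V) (e : Fin q → ℤ)
    (y : Fin q → V), (∀ a, x a ∈ 𝒱 (d a)) → (∀ b, y b ∈ 𝒱 (e b)) →
    M p q (symProd 𝒱 p x ⊗ₜ[K] symProd 𝒱 q y) ∈ 𝒱 (∑ a, d a + ∑ b, e b + 1)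
  maurerCartan : ∀ n m : ℕ, 1 ≤ m → ∀ (d : Fin n → ℤ) (x : Fin n → V) (e : Fin m → ℤ)
    (y : Fin m → V), (∀ a, x a ∈ 𝒱 (d a)) → (∀ b, y b ∈ 𝒱 (e b)) →
    (∑ j ∈ Finset.range n, ∑ i ∈ Finset.Icc 1 (n - j), ∑ σ ∈ shuffles₃ n j i,
      koszulSign d σ •
        M (n - j - i + 1) m
          (symProd 𝒱 (n - j - i + 1)
              (Fin.cons
                (M j i
                  (symProd 𝒱 j (block (x ∘ σ) 0 j) ⊗ₜ[K] symProd 𝒱 i (block (x ∘ σ) j i)))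
                (block (x ∘ σ) (j + i) (n - j - i)))
            ⊗ₜ[K] symProd 𝒱 m y))
    + (∑ j ∈ Finset.range (n + 1), ∑ i ∈ Finset.Icc 1 m,
        ∑ σ ∈ shuffles₂ n (n - j), ∑ τ ∈ shuffles₂ m i,
      (koszulSign d σ * koszulSign e τ *
          Int.negOnePow (∑ a : Fin (n - j), block (d ∘ σ) 0 (n - j) a)) •
        M (n - j) (m - i + 1)
          (symProd 𝒱 (n - j) (block (x ∘ σ) 0 (n - j))
            ⊗ₜ[K] symProd 𝒱 (m - i + 1)
              (Fin.cons
                (M j i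
                  (symProd 𝒱 j (block (x ∘ σ) (n - j) j)
                    ⊗ₜ[K] symProd 𝒱 i (block (y ∘ τ) 0 i)))
                (block (y ∘ τ) i (m - i))))) = 0

variable {𝒱}

/-- The family `{M p q}_{p ≥ 0, q ≥ 1}`, completed by `M p 0 = 0`. -/
def extendByZero (M : ∀ p q : ℕ, GSym 𝒱 p ⊗[K] GSym 𝒱 q →ₗ[K] V) :
    ∀ p q : ℕ, GSym 𝒱 p ⊗[K] GSym 𝒱 q →ₗ[K] V
  | _, 0 => 0
  | p, q + 1 => M p (q + 1)

end Structures

/-! ### The sub-adjacent brackets -/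

section Subadjacent

variable {K : Type*} [Field K] {V : Type*} [AddCommGroup V] [Module K V]
  {𝒱 : ℤ → Submodule K V}

/-- `(x₁, …, x_k) ↦ f (x₁ ⋯ x_j ⊗ x_{j+1} ⋯ x_k)` as a multilinear map, for `j + l = k`. -/
def splitEval {j l k : ℕ} (h : j + l = k) (f : GSym 𝒱 j ⊗[K] GSym 𝒱 l →ₗ[K] V) :
    MultilinearMap K (fun _ : Fin k => V) V :=
  (f.compMultilinearMap ((symProd 𝒱 j).domCoprod (symProd 𝒱 l))).domDomCongr
    (finSumFinEquiv.trans (finCongr h))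

theorem splitEval_apply {j l k : ℕ} (h : j + l = k) (f : GSym 𝒱 j ⊗[K] GSym 𝒱 l →ₗ[K] V)
    (x : Fin k → V) :
    splitEval h f x = f (symProd 𝒱 j (block x 0 j) ⊗ₜ[K] symProd 𝒱 l (block x j l)) := by
  subst h
  have h1 : block x 0 j = fun a => x (Fin.castAdd l a) := by
    funext a
    have : (a : ℕ) < j + l := by omega
    simp [block, Fin.castAdd, Fin.castLE, this]
  have h2 : block x j l = fun a => x (Fin.natAdd j a) := by
    funext a
    simp [block, Fin.natAdd]
  rw [h1, h2]
  rfl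

/-- The value of `l^C_k` on homogeneous elements of degrees `d₁, …, d_k`, as a multilinear map:
`∑_{j=0}^{k-1} ∑_σ ε(σ) M_{j,k-j}(x_{σ(1)} ⋯ x_{σ(j)} ⊗ x_{σ(j+1)} ⋯ x_{σ(k)})`, the inner sum
over the `(j, k-j)`-shuffles `σ`. -/
def subadjacentAt (M : ∀ p q : ℕ, GSym 𝒱 p ⊗[K] GSym 𝒱 q →ₗ[K] V) (k : ℕ) (d : Fin k → ℤ) :
    MultilinearMap K (fun _ : Fin k => V) V :=
  ∑ j : Fin k, ∑ σ ∈ shuffles₂ k j, koszulSign d σ •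
    (splitEval (Nat.add_sub_cancel' j.isLt.le) (M j (k - j))).domDomCongr σ

/-- The sub-adjacent bracket `l^C_k : V^{⊗ k} → V`, extended multilinearly from homogeneous
elements. -/
noncomputable def subadjacent [DirectSum.Decomposition 𝒱]
    (M : ∀ p q : ℕ, GSym 𝒱 p ⊗[K] GSym 𝒱 q →ₗ[K] V) (k : ℕ) :
    MultilinearMap K (fun _ : Fin k => V) V :=
  (MultilinearMap.fromDirectSumEquiv (R := K) (M := fun (_ : Fin k) (c : ℤ) => 𝒱 c)
    (fun d => (subadjacentAt M k d).compLinearMap (fun a => (𝒱 (d a)).subtype))).compLinearMap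
      (fun _ => (DirectSum.decomposeLinearEquiv 𝒱).toLinearMap)

end Subadjacent

end PostLieInfinity

/-!
Write `|A|` for the total degree of a list `A` of homogeneous elements, set `M p 0 = 0`, and let
`l(A) = ∑ ± M(B ⊗ C)` be the sub-adjacent bracket, the sum over all unshuffles of `A` into two
lists `B`, `C`. With this convention every condition that a group of arguments is nonempty can be
dropped from the identities, because the additional terms vanish.

Sums over shuffles are handled through the coproduct of the graded symmetric coalgebra, in the
form of the operator `unshuffleSum` on lists, which is defined by recursion on the list. Its
coassociativity (`unshuffleSum_coassoc`) and graded cocommutativity (`unshuffleSum_cocomm`) are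
proved by induction on the list. The comparison with sums over shuffle permutations
(`sum_shuffles₃`, `sum_shuffles₂`) is an induction on the number of arguments: a permutation of
`n + 1` symbols arises from one of `n` symbols by inserting the symbol `0` (`insertZero`), the
result is a shuffle exactly when `0` leads one of the blocks, and its Koszul sign is that of the
smaller permutation times the sign of moving `0` to the front.

The post-Lie`∞` identity for the arguments `C ⊗ D` becomes the vanishing of `postLieExpr`: the sum
of the terms `M(M(J ⊗ I) A ⊗ D)` over unshuffles of `C` into `J`, `I`, `A`, and of the terms
`(-1)^|A| M(A ⊗ M(J ⊗ I) B)` over unshuffles of `C` into `A`, `J` and of `D` into `I`, `B`.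

* Splitting `C` into `J`, `I`, `A` amounts to splitting it into `J I` and `A` and then splitting
  `J I`, so the first kind of terms is `M(l(I) A ⊗ D)`. Hence the post-Lie`∞` identity is literally
  the compatibility condition of an open-closed homotopy Lie algebra.
* The Jacobi expression of `l` at `L` is the sum of `± postLieExpr C D` over all unshuffles of `L`
  into `C`, `D` (`unshuffleSum_bracket_bracket`): the inner bracket enters either the first or the
  second group of arguments of the outer operation, and these two cases give the two kinds of terms.
* The bracket `l` is graded symmetric because `M` is, and since exchanging two adjacent arguments
  only permutes the terms of `unshuffleSum` (`IsSwapSymmetric.unshuffleSum`). Symmetry under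
  adjacent exchanges implies symmetry under all permutations (`IsSwapSymmetric.comp_perm`).
-/

namespace PostLieInfinity

/-! ### Signed sums over unshuffles of a list -/

section Unshuffle

variable {P : Type*} (deg : P → ℤ) {N : Type*} [AddCommGroup N]

/-- The total degree of a list of homogeneous elements. -/
def degSum (L : List P) : ℤ := (L.map deg).sum

@[simp] theorem degSum_nil : degSum deg ([] : List P) = 0 := rfl

@[simp] theorem degSum_cons (x : P) (L : List P) :
    degSum deg (x :: L) = deg x + degSum deg L := by simp [degSum]

@[simp] theorem degSum_append (A B : List P) :
    degSum deg (A ++ B) = degSum deg A + degSum deg B := by simp [degSum]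

/-- The sum of `± f A B` over all ways to distribute the entries of the list `L` over two lists
`A`, `B` (each keeping the order of `L`), with the Koszul sign of the rearrangement of `L` into
`A ++ B`. This is `f` applied to the coproduct of the graded symmetric coalgebra; the recursion
expresses that the coproduct is an algebra map. -/
def unshuffleSum : List P → (List P → List P → N) → N
  | [], f => f [] []
  | x :: L, f => unshuffleSum L (fun A B => f (x :: A) B) +
      unshuffleSum L (fun A B => Int.negOnePow (deg x * degSum deg A) • f A (x :: B))

/-- The analogue of `unshuffleSum` for distributions over three lists. -/
def unshuffleSum₃ (L : List P) (f : List P → List P → List P → N) : N :=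
  unshuffleSum deg L fun D C => unshuffleSum deg D fun A B => f A B C

variable {deg}

theorem unshuffleSum_congr {L : List P} {f g : List P → List P → N}
    (h : ∀ A B, A.length + B.length = L.length → degSum deg A + degSum deg B = degSum deg L →
      f A B = g A B) :
    unshuffleSum deg L f = unshuffleSum deg L g := by
  induction L generalizing f g with
  | nil => exact h [] [] rfl rfl
  | cons x L ih =>
    simp only [unshuffleSum]
    congr 1
    · refine ih fun A B h1 h2 => h _ _ ?_ ?_
      · simp only [List.length_cons]; omega
      · simp only [degSum_cons]; omega
    · refine ih fun A B h1 h2 => ?_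
      rw [h]
      · simp only [List.length_cons]; omega
      · simp only [degSum_cons]; omega

variable (deg) in
@[simp] theorem unshuffleSum_zero (L : List P) :
    unshuffleSum deg L (fun _ _ => (0 : N)) = 0 := by
  induction L with
  | nil => rfl
  | cons x L ih => simp [unshuffleSum, ih]

variable (deg) in
theorem unshuffleSum_add (L : List P) (f g : List P → List P → N) :
    unshuffleSum deg L (fun A B => f A B + g A B) =
      unshuffleSum deg L f + unshuffleSum deg L g := by
  induction L generalizing f g with
  | nil => rfl
  | cons x L ih => simp only [unshuffleSum, smul_add, ih]; abel

theorem map_unshuffleSum {N' F : Type*} [AddCommGroup N'] [FunLike F N N']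
    [AddMonoidHomClass F N N'] (φ : F) (L : List P) (f : List P → List P → N) :
    φ (unshuffleSum deg L f) = unshuffleSum deg L (fun A B => φ (f A B)) := by
  induction L generalizing f with
  | nil => rfl
  | cons x L ih => simp only [unshuffleSum, map_add, ih, Units.smul_def, map_zsmul]

variable (deg) in
theorem smul_unshuffleSum (s : ℤˣ) (L : List P) (f : List P → List P → N) :
    s • unshuffleSum deg L f = unshuffleSum deg L (fun A B => s • f A B) :=
  map_unshuffleSum (DistribSMul.toAddMonoidHom N s) L f

theorem unshuffleSum_mem {S : AddSubgroup N} {L : List P} {f : List P → List P → N}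
    (h : ∀ A B, degSum deg A + degSum deg B = degSum deg L → f A B ∈ S) :
    unshuffleSum deg L f ∈ S := by
  rw [← QuotientAddGroup.eq_zero_iff]
  change QuotientAddGroup.mk' S _ = 0
  rw [map_unshuffleSum, ← unshuffleSum_zero deg L]
  exact unshuffleSum_congr fun A B _ hAB => (QuotientAddGroup.eq_zero_iff _).2 (h A B hAB)

variable (deg) in
theorem unshuffleSum_sum {ι : Type*} (s : Finset ι) (L : List P) (f : ι → List P → List P → N) :
    unshuffleSum deg L (fun A B => ∑ i ∈ s, f i A B) = ∑ i ∈ s, unshuffleSum deg L (f i) := by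
  classical
  induction s using Finset.induction_on with
  | empty => simp
  | insert a s ha ih => simp only [Finset.sum_insert ha, unshuffleSum_add, ih]

variable (deg) in
/-- The counit law of the coproduct. -/
theorem unshuffleSum_ite_nil (L : List P) (g : List P → N) :
    unshuffleSum deg L (fun A B => if A.length = 0 then g B else 0) = g L := by
  induction L generalizing g with
  | nil => rfl
  | cons x L ih =>
    simp only [unshuffleSum, List.length_cons, Nat.add_eq_zero_iff, one_ne_zero, and_false,
      if_false, unshuffleSum_zero, zero_add]
    rw [← ih (fun B => g (x :: B))]
    refine unshuffleSum_congr fun A B _ _ => ?_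
    split_ifs with h
    · rw [List.length_eq_zero_iff] at h
      simp [h]
    · simp

variable (deg) in
/-- Coassociativity of the coproduct. -/
theorem unshuffleSum_coassoc (L : List P) (f : List P → List P → List P → N) :
    unshuffleSum deg L (fun D C => unshuffleSum deg D fun A B => f A B C) =
      unshuffleSum deg L (fun A D => unshuffleSum deg D fun B C => f A B C) := by
  induction L generalizing f with
  | nil => rfl
  | cons x L ih =>
    simp only [unshuffleSum, smul_add, unshuffleSum_add, smul_unshuffleSum]
    rw [ih, ih, add_assoc]
    congr 2
    rw [← ih fun A B C => Int.negOnePow (deg x * degSum deg A) •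
      Int.negOnePow (deg x * degSum deg B) • f A B (x :: C)]
    refine unshuffleSum_congr fun D C _ _ => unshuffleSum_congr fun A B _ h => ?_
    rw [smul_smul, ← Int.negOnePow_add, ← h, mul_add]

/-- The sign of exchanging two homogeneous elements, applied twice, is trivial. -/
theorem negOnePow_mul_swap (a b : ℤ) : Int.negOnePow (a * b) * Int.negOnePow (b * a) = 1 := by
  rw [mul_comm b a, ← Int.negOnePow_add]
  exact Int.negOnePow_even _ ⟨_, rfl⟩

variable (deg) in
/-- Graded cocommutativity of the coproduct. -/
theorem unshuffleSum_cocomm (L : List P) (f : List P → List P → N) :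
    unshuffleSum deg L f = unshuffleSum deg L
      (fun A B => Int.negOnePow (degSum deg A * degSum deg B) • f B A) := by
  induction L generalizing f with
  | nil => simp [unshuffleSum]
  | cons x L ih =>
    simp only [unshuffleSum, degSum_cons]
    rw [ih, ih (fun A B => _ • f A (x :: B)), add_comm]
    congr 1 <;> refine unshuffleSum_congr fun A B _ _ => ?_ <;> simp only [smul_smul]
    · rw [add_mul, Int.negOnePow_add, mul_comm]
    · rw [mul_add, Int.negOnePow_add, ← mul_assoc, mul_comm (degSum deg A) (deg x),
        ← Int.negOnePow_add, Int.negOnePow_even (deg x * _ + _) ⟨_, rfl⟩, one_mul]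

variable (deg) in
theorem unshuffleSum_comm {Q : Type*} (deg' : Q → ℤ) (L : List P) (L' : List Q)
    (f : List P → List P → List Q → List Q → N) :
    unshuffleSum deg L (fun A B => unshuffleSum deg' L' fun C D => f A B C D) =
      unshuffleSum deg' L' (fun C D => unshuffleSum deg L fun A B => f A B C D) := by
  induction L generalizing f with
  | nil => rfl
  | cons x L ih => simp only [unshuffleSum, unshuffleSum_add, smul_unshuffleSum, ih]

variable (deg) in
theorem unshuffleSum₃_cons (x : P) (L : List P) (f : List P → List P → List P → N) :
    unshuffleSum₃ deg (x :: L) f =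
      unshuffleSum₃ deg L (fun A B C => f (x :: A) B C) +
      unshuffleSum₃ deg L (fun A B C => Int.negOnePow (deg x * degSum deg A) • f A (x :: B) C) +
      unshuffleSum₃ deg L (fun A B C =>
        Int.negOnePow (deg x * (degSum deg A + degSum deg B)) • f A B (x :: C)) := by
  simp only [unshuffleSum₃, unshuffleSum, unshuffleSum_add, smul_unshuffleSum]
  congr 1
  exact unshuffleSum_congr fun D C _ _ => unshuffleSum_congr fun A B _ h => by rw [h]

theorem unshuffleSum₃_congr {L : List P} {f g : List P → List P → List P → N}
    (h : ∀ A B C, A.length + B.length + C.length = L.length → f A B C = g A B C) :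
    unshuffleSum₃ deg L f = unshuffleSum₃ deg L g :=
  unshuffleSum_congr fun D C h1 _ => unshuffleSum_congr fun A B h2 _ => h A B C (by omega)

variable (deg) in
@[simp] theorem unshuffleSum₃_zero (L : List P) :
    unshuffleSum₃ deg L (fun _ _ _ => (0 : N)) = 0 := by simp [unshuffleSum₃]

variable (deg) in
theorem unshuffleSum₃_sum {ι : Type*} (s : Finset ι) (L : List P)
    (f : ι → List P → List P → List P → N) :
    unshuffleSum₃ deg L (fun A B C => ∑ i ∈ s, f i A B C) =
      ∑ i ∈ s, unshuffleSum₃ deg L (f i) := by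
  simp only [unshuffleSum₃, unshuffleSum_sum]

variable (deg) in
/-- `f` changes by the Koszul sign when two adjacent entries of its argument are exchanged. -/
def IsSwapSymmetric (f : List P → N) : Prop :=
  ∀ (A : List P) (x y : P) (B : List P),
    f (A ++ x :: y :: B) = Int.negOnePow (deg x * deg y) • f (A ++ y :: x :: B)

theorem IsSwapSymmetric.cons {f : List P → N} (h : IsSwapSymmetric deg f) (a : P) :
    IsSwapSymmetric deg (fun L => f (a :: L)) :=
  fun A x y B => h (a :: A) x y B

/-- The sign in the recursion for `unshuffleSum` depends only on the total degree. -/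
theorem IsSwapSymmetric.smul {f : List P → N} (h : IsSwapSymmetric deg f) (a : ℤ) :
    IsSwapSymmetric deg (fun L => Int.negOnePow (a * degSum deg L) • f L) := by
  intro A x y B
  simp only [h A x y B, degSum_append, degSum_cons]
  rw [smul_comm, add_left_comm (deg x)]

theorem IsSwapSymmetric.const_smul {f : List P → N} (h : IsSwapSymmetric deg f) (s : ℤˣ) :
    IsSwapSymmetric deg (fun L => s • f L) := by
  intro A x y B
  simp only [h A x y B, smul_comm s]

theorem IsSwapSymmetric.unshuffleSum {f : List P → List P → N}
    (h1 : ∀ B, IsSwapSymmetric deg (fun A => f A B)) (h2 : ∀ A, IsSwapSymmetric deg (f A)) :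
    IsSwapSymmetric deg (fun L => unshuffleSum deg L f) := by
  intro A x y B
  induction A generalizing f with
  | nil =>
    simp only [List.nil_append, PostLieInfinity.unshuffleSum, smul_add, smul_unshuffleSum]
    have e1 : ∀ A B, f (x :: y :: A) B = Int.negOnePow (deg x * deg y) • f (y :: x :: A) B :=
      fun A B => h1 B [] x y A
    have e2 : ∀ A B, f A (x :: y :: B) = Int.negOnePow (deg x * deg y) • f A (y :: x :: B) :=
      fun A B => h2 A [] x y B
    simp only [e1, e2, smul_smul, degSum_cons, mul_add, Int.negOnePow_add]
    have e3 : Int.negOnePow (deg x * deg y) * Int.negOnePow (deg y * deg x) = 1 :=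
      negOnePow_mul_swap _ _
    simp only [← mul_assoc, e3, one_mul]
    rw [add_add_add_comm]
    congr 2
    refine unshuffleSum_congr fun A B _ _ => ?_
    congr 1
    ac_rfl
  | cons a A ih =>
    simp only [List.cons_append, PostLieInfinity.unshuffleSum, smul_add]
    exact congrArg₂ (· + ·) (ih (fun B => (h1 B).cons a) (fun A => h2 _))
      (ih (fun B => (h1 _).smul _) (fun A => ((h2 A).cons a).const_smul _))

end Unshuffle

/-! ### Insertion of the smallest symbol into a permutation -/

section Insertion

/-- The permutation of `n + 1` symbols whose one-line notation arises from that of `σ` (with all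
symbols raised by one) by inserting the symbol `0` at position `p`. -/
def insertZero {n : ℕ} (p : Fin (n + 1)) (σ : Equiv.Perm (Fin n)) : Equiv.Perm (Fin (n + 1)) :=
  (finSuccEquiv' p).trans (σ.optionCongr.trans (finSuccEquiv' 0).symm)

@[simp] theorem insertZero_self {n : ℕ} (p : Fin (n + 1)) (σ : Equiv.Perm (Fin n)) :
    insertZero p σ p = 0 := by
  simp [insertZero]

@[simp] theorem insertZero_succAbove {n : ℕ} (p : Fin (n + 1)) (σ : Equiv.Perm (Fin n))
    (a : Fin n) : insertZero p σ (p.succAbove a) = (σ a).succ := by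
  simp [insertZero]

theorem insertZero_bijective (n : ℕ) :
    Function.Bijective (fun q : Fin (n + 1) × Equiv.Perm (Fin n) => insertZero q.1 q.2) := by
  rw [Fintype.bijective_iff_injective_and_card]
  constructor
  · rintro ⟨p, σ⟩ ⟨q, τ⟩ h
    replace h : insertZero p σ = insertZero q τ := h
    have hpq : p = q := (insertZero q τ).injective (by rw [insertZero_self, ← h, insertZero_self])
    subst hpq
    congr 1
    ext a : 1
    have := DFunLike.congr_fun h (p.succAbove a)
    simpa using this
  · simp [Fintype.card_perm, Nat.factorial_succ]

theorem exists_eq_insertZero {n : ℕ} (σ : Equiv.Perm (Fin (n + 1))) :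
    ∃ p τ, σ = insertZero p τ := by
  obtain ⟨⟨p, τ⟩, h⟩ := (insertZero_bijective n).surjective σ
  exact ⟨p, τ, h.symm⟩

theorem sum_perm_succ {n : ℕ} {N : Type*} [AddCommMonoid N]
    (f : Equiv.Perm (Fin (n + 1)) → N) :
    ∑ σ, f σ = ∑ p, ∑ σ, f (insertZero p σ) := by
  rw [← Fintype.sum_prod_type', ← (insertZero_bijective n).sum_comp]

theorem ofFn_eq_take_append_drop {n : ℕ} {α : Type*} (w : Fin (n + 1) → α) (p : Fin (n + 1)) :
    List.ofFn w = (List.ofFn fun a => w (p.succAbove a)).take p ++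
      w p :: (List.ofFn fun a => w (p.succAbove a)).drop p := by
  induction n with
  | zero => obtain rfl := Fin.fin_one_eq_zero p; simp
  | succ n ih =>
    induction p using Fin.cases with
    | zero => simp
    | succ p =>
      rw [List.ofFn_succ, ih (fun a => w a.succ) p, List.ofFn_succ (f := fun a => _)]
      simp

theorem ofFn_comp_insertZero {n : ℕ} {α : Type*} (z : Fin (n + 1) → α) (p : Fin (n + 1))
    (σ : Equiv.Perm (Fin n)) :
    List.ofFn (fun a => z (insertZero p σ a)) =
      (List.ofFn fun a => z (σ a).succ).take p ++
        z 0 :: (List.ofFn fun a => z (σ a).succ).drop p := by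
  rw [ofFn_eq_take_append_drop _ p]
  simp

/-- The exchanges of an element of degree `c` with the first `p` entries of `w` contribute the sign
`(-1)^{c d}` in total, where `d` is the sum of the degrees of these entries. -/
theorem prod_ite_negOnePow {n : ℕ} {P : Type*} (deg : P → ℤ) (w : Fin n → P) (c : ℤ) (p : ℕ) :
    ∏ a : Fin n, (if (a : ℕ) < p then Int.negOnePow (deg (w a) * c) else 1) =
      Int.negOnePow (c * degSum deg ((List.ofFn w).take p)) := by
  induction n generalizing p with
  | zero => simp
  | succ n ih =>
    cases p with
    | zero => simp
    | succ p =>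
      rw [Fin.prod_univ_succ]
      simp only [Fin.val_zero, Nat.zero_lt_succ, if_true, Fin.val_succ, Nat.add_lt_add_iff_right,
        ih, List.ofFn_succ, List.take_succ_cons, degSum_cons, mul_add, Int.negOnePow_add,
        mul_comm c (deg _)]

/-- Moving the first factor to position `p` exchanges it with the `p` factors in front of it. -/
theorem koszulSign_insertZero {n : ℕ} {P : Type*} (deg : P → ℤ) (z : Fin (n + 1) → P)
    (p : Fin (n + 1)) (σ : Equiv.Perm (Fin n)) :
    koszulSign (fun a => deg (z a)) (insertZero p σ) =
      Int.negOnePow (deg (z 0) * degSum deg ((List.ofFn fun a => z (σ a).succ).take p)) *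
        koszulSign (fun a => deg (z a.succ)) σ := by
  rw [← prod_ite_negOnePow]
  unfold koszulSign
  rw [Fin.prod_univ_succAbove _ p, Finset.prod_eq_one, one_mul]
  · simp_rw [Fin.prod_univ_succAbove _ p]
    rw [Finset.prod_mul_distrib]
    congr 1
    · refine Finset.prod_congr rfl fun a _ => ?_
      have h : p.succAbove a < p ↔ (a : ℕ) < p := Fin.succAbove_lt_iff_castSucc_lt p a
      simp [h]
    · simp
  · intro b _
    simp

/-- A permutation is a shuffle exactly when its symbol `0` leads one of the blocks and removing `0`
leaves a shuffle of the remaining symbols. -/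
theorem insertZero_mem_shuffles₃ {n : ℕ} (j i : ℕ) (p : Fin (n + 1)) (σ : Equiv.Perm (Fin n)) :
    insertZero p σ ∈ shuffles₃ (n + 1) j i ↔
      ((p : ℕ) = 0 ∧ 1 ≤ j ∧ σ ∈ shuffles₃ n (j - 1) i) ∨
      ((p : ℕ) = j ∧ 1 ≤ i ∧ σ ∈ shuffles₃ n j (i - 1)) ∨
      ((p : ℕ) = j + i ∧ σ ∈ shuffles₃ n j i) := by
  have hval : ∀ a : Fin n, (p.succAbove a : ℕ) = if (a : ℕ) < p then (a : ℕ) else a + 1 := by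
    intro a
    by_cases h : a.castSucc < p
    · rw [Fin.succAbove_of_castSucc_lt _ _ h, if_pos (by simpa [Fin.lt_def] using h)]; rfl
    · rw [Fin.succAbove_of_le_castSucc _ _ (not_lt.1 h),
        if_neg (by simpa [Fin.lt_def] using h)]; rfl
  simp only [shuffles₃, Finset.mem_filter, Finset.mem_univ, true_and]
  constructor
  · intro H
    -- the entry before the inserted `0` lies in a different block
    have H1 : ∀ a : Fin n, (a : ℕ) < p →
        ¬ ((p : ℕ) < j ∨ (j ≤ (a : ℕ) ∧ (p : ℕ) < j + i) ∨ j + i ≤ (a : ℕ)) := by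
      intro a ha hc
      have := H (p.succAbove a) p
        (by rw [Fin.lt_def, hval, if_pos ha]; exact ha) (by rw [hval, if_pos ha]; exact hc)
      simp at this
    have H2 : ∀ a b : Fin n, a < b → (((p.succAbove b : Fin (n + 1)) : ℕ) < j ∨
        (j ≤ ((p.succAbove a : Fin (n + 1)) : ℕ) ∧ ((p.succAbove b : Fin (n + 1)) : ℕ) < j + i) ∨
          j + i ≤ ((p.succAbove a : Fin (n + 1)) : ℕ)) → σ a < σ b := by
      intro a b hab hc
      have := H (p.succAbove a) (p.succAbove b) (Fin.succAbove_lt_succAbove_iff.2 hab) hc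
      simpa using this
    have hp := p.isLt
    have hcases : ((p : ℕ) = 0 ∧ 1 ≤ j) ∨ ((p : ℕ) = j ∧ 1 ≤ i) ∨ (p : ℕ) = j + i := by
      by_cases h0 : (p : ℕ) = 0
      · omega
      · have := H1 ⟨p - 1, by omega⟩ (by simp only; omega)
        simp only at this
        omega
    rcases hcases with ⟨h, h'⟩ | ⟨h, h'⟩ | h
    · refine Or.inl ⟨h, h', fun a b hab hc => H2 a b hab ?_⟩
      rw [hval, hval]; rw [Fin.lt_def] at hab; split_ifs <;> omega
    · refine Or.inr (Or.inl ⟨h, h', fun a b hab hc => H2 a b hab ?_⟩)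
      rw [hval, hval]; rw [Fin.lt_def] at hab; split_ifs <;> omega
    · refine Or.inr (Or.inr ⟨h, fun a b hab hc => H2 a b hab ?_⟩)
      rw [hval, hval]; rw [Fin.lt_def] at hab; split_ifs <;> omega
  · intro H a b
    induction a using Fin.succAboveCases p with
    | x => 
      induction b using Fin.succAboveCases p with
      | x => simp
      | p b => simp
    | p a =>
      induction b using Fin.succAboveCases p with
      | x =>
        intro hab hc
        exfalso
        rw [Fin.lt_def, hval] at hab
        rw [hval] at hc
        split_ifs at hab hc <;> omega
      | p b =>
        intro hab hc
        rw [Fin.succAbove_lt_succAbove_iff] at hab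
        have hab' := hab
        rw [hval, hval] at hc
        rw [Fin.lt_def] at hab'
        simp only [insertZero_succAbove, Fin.succ_lt_succ_iff]
        rcases H with ⟨h, h', H⟩ | ⟨h, h', H⟩ | ⟨h, H⟩ <;> refine H a b hab ?_ <;>
          split_ifs at hc <;> omega

end Insertion

/-! ### Sums over shuffles as sums over unshuffles of lists -/

section Bridge

variable {P : Type*} (deg : P → ℤ) {N : Type*}

theorem blocks_append {α : Type*} (A B C : List α) :
    (A ++ (B ++ C)).take A.length = A ∧
      ((A ++ (B ++ C)).drop A.length).take B.length = B ∧
      (A ++ (B ++ C)).drop (A.length + B.length) = C := by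
  refine ⟨by simp, by simp, ?_⟩
  rw [← List.drop_drop]
  simp

/-- `F` evaluated at the first `j` entries, the next `i` entries and the remaining entries of a
list. -/
def evalBlocks (F : List P → List P → List P → N) (j i : ℕ) (l : List P) : N :=
  F (l.take j) ((l.drop j).take i) (l.drop (j + i))

theorem evalBlocks_append (F : List P → List P → List P → N) {j i : ℕ} {A B C : List P}
    (hA : A.length = j) (hB : B.length = i) : evalBlocks F j i (A ++ (B ++ C)) = F A B C := by
  subst hA hB
  obtain ⟨h1, h2, h3⟩ := blocks_append A B C
  rw [evalBlocks, h1, h2, h3]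

variable [AddCommGroup N]

theorem sum_ite_val_eq {n : ℕ} (c : ℕ) (X : N) :
    ∑ p : Fin (n + 1), (if (p : ℕ) = c then X else 0) = if c ≤ n then X else 0 := by
  split_ifs with h
  · rw [Finset.sum_eq_single ⟨c, by omega⟩]
    · simp
    · intro b _ hb
      rw [if_neg]
      exact fun hc => hb (Fin.ext hc)
    · simp
  · exact Finset.sum_eq_zero fun p _ => if_neg (by omega)

/-- The signed sum of `F`, evaluated at the three blocks, over the `(j, i, n-j-i)`-shuffles. It is
written as a sum over all permutations, so that `sum_perm_succ` applies. -/
def shuffleSum₃ {n : ℕ} (z : Fin n → P) (j i : ℕ) (F : List P → List P → List P → N) : N :=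
  ∑ σ : Equiv.Perm (Fin n), if σ ∈ shuffles₃ n j i then
    koszulSign (fun a => deg (z a)) σ • evalBlocks F j i (List.ofFn fun a => z (σ a)) else 0

/-- In a shuffle the entry `z 0` leads one of the three blocks. The three terms match those of
`unshuffleSum₃_cons`. -/
theorem shuffleSum₃_succ {n : ℕ} (z : Fin (n + 1) → P) (j i : ℕ) (h : j + i ≤ n + 1)
    (F : List P → List P → List P → N) :
    shuffleSum₃ deg z j i F =
      (if 1 ≤ j then shuffleSum₃ deg (fun a => z a.succ) (j - 1) i
        (fun A B C => F (z 0 :: A) B C) else 0) +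
      (if 1 ≤ i then shuffleSum₃ deg (fun a => z a.succ) j (i - 1)
        (fun A B C => Int.negOnePow (deg (z 0) * degSum deg A) • F A (z 0 :: B) C) else 0) +
      (if j + i ≤ n then shuffleSum₃ deg (fun a => z a.succ) j i
        (fun A B C => Int.negOnePow (deg (z 0) * (degSum deg A + degSum deg B)) •
          F A B (z 0 :: C)) else 0) := by
  have key : ∀ (p : Fin (n + 1)) (σ : Equiv.Perm (Fin n)),
      (if insertZero p σ ∈ shuffles₃ (n + 1) j i then
        koszulSign (fun a => deg (z a)) (insertZero p σ) •
          evalBlocks F j i (List.ofFn fun a => z (insertZero p σ a)) else 0) =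
      (if (p : ℕ) = 0 then (if 1 ≤ j then (if σ ∈ shuffles₃ n (j - 1) i then
        koszulSign (fun a => deg (z a.succ)) σ •
          evalBlocks (fun A B C => F (z 0 :: A) B C) (j - 1) i
            (List.ofFn fun a => z (σ a).succ) else 0) else 0) else 0) +
      (if (p : ℕ) = j then (if 1 ≤ i then (if σ ∈ shuffles₃ n j (i - 1) then
        koszulSign (fun a => deg (z a.succ)) σ •
          evalBlocks (fun A B C => Int.negOnePow (deg (z 0) * degSum deg A) •
            F A (z 0 :: B) C) j (i - 1) (List.ofFn fun a => z (σ a).succ) else 0) else 0) else 0) +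
      (if (p : ℕ) = j + i then (if σ ∈ shuffles₃ n j i then
        koszulSign (fun a => deg (z a.succ)) σ •
          evalBlocks (fun A B C => Int.negOnePow (deg (z 0) * (degSum deg A + degSum deg B)) •
            F A B (z 0 :: C)) j i (List.ofFn fun a => z (σ a).succ) else 0) else 0) := by
    intro p σ
    have hp := p.isLt
    have hl : (List.ofFn fun a => z (σ a).succ).length = n := List.length_ofFn
    by_cases hm : insertZero p σ ∈ shuffles₃ (n + 1) j i
    · rw [if_pos hm, koszulSign_insertZero, ofFn_comp_insertZero]
      generalize (List.ofFn fun a => z (σ a).succ) = l at hl ⊢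
      rw [insertZero_mem_shuffles₃] at hm
      rcases hm with ⟨h1, h2, h3⟩ | ⟨h1, h2, h3⟩ | ⟨h1, h3⟩
      · rw [if_pos h1, if_pos h2, if_pos h3, h1]
        rw [if_neg (by omega : ¬ 0 = j), if_neg (by omega : ¬ 0 = j + i)]
        obtain ⟨j, rfl⟩ : ∃ k, j = k + 1 := ⟨j - 1, by omega⟩
        simp [evalBlocks, Nat.add_right_comm j 1 i]
      · rw [← ite_and, if_neg (by omega : ¬ ((p : ℕ) = 0 ∧ 1 ≤ j)), if_pos h1, if_pos h2,
          if_pos h3, if_neg (by omega : ¬ (p : ℕ) = j + i), h1]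
        obtain ⟨i, rfl⟩ : ∃ k, i = k + 1 := ⟨i - 1, by omega⟩
        have hd : l.drop j = (l.drop j).take i ++ l.drop (j + i) := by
          rw [← List.drop_drop, List.take_append_drop]
        have hA : (l.take j).length = j := by rw [List.length_take]; omega
        have hB : ((l.drop j).take i).length = i := by
          rw [List.length_take, List.length_drop]; omega
        rw [hd, ← List.cons_append, evalBlocks_append F hA (by rw [List.length_cons, hB]),
          Nat.add_sub_cancel, zero_add, add_zero]
        rw [evalBlocks, smul_smul, mul_comm]
      · rw [← ite_and, if_neg (by omega : ¬ ((p : ℕ) = 0 ∧ 1 ≤ j)), ← ite_and,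
          if_neg (by omega : ¬ ((p : ℕ) = j ∧ 1 ≤ i)), if_pos h1, if_pos h3, h1]
        have hA : (l.take j).length = j := by rw [List.length_take]; omega
        have hB : ((l.drop j).take i).length = i := by
          rw [List.length_take, List.length_drop]; omega
        rw [List.take_add, List.append_assoc, evalBlocks_append F hA hB, zero_add, zero_add,
          evalBlocks, smul_smul, mul_comm, degSum_append]
    · rw [if_neg hm]
      rw [insertZero_mem_shuffles₃] at hm
      push Not at hm
      obtain ⟨h1, h2, h3⟩ := hm
      symm
      split_ifs <;> simp_all
  rw [shuffleSum₃, sum_perm_succ]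
  rw [Finset.sum_comm]
  simp only [key, Finset.sum_add_distrib, sum_ite_val_eq, shuffleSum₃]
  congr 1
  · congr 1
    · simp only [Nat.zero_le, if_true]
      split_ifs <;> simp
    · by_cases hi : 1 ≤ i
      · simp only [if_pos hi, if_pos (by omega : j ≤ n)]
      · simp only [if_neg hi, ite_self, Finset.sum_const_zero]
  · split_ifs <;> simp

theorem shuffleSum₃_eq {n : ℕ} (z : Fin n → P) (j i : ℕ) (h : j + i ≤ n)
    (F : List P → List P → List P → N) :
    shuffleSum₃ deg z j i F = unshuffleSum₃ deg (List.ofFn z)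
      (fun A B C => if A.length = j ∧ B.length = i then F A B C else 0) := by
  induction n generalizing j i F with
  | zero =>
    obtain rfl : j = 0 := by omega
    obtain rfl : i = 0 := by omega
    simp [shuffleSum₃, unshuffleSum₃, unshuffleSum, shuffles₃, koszulSign, evalBlocks]
  | succ n ih =>
    rw [shuffleSum₃_succ deg z j i h, List.ofFn_succ, unshuffleSum₃_cons]
    congr 1
    · congr 1
      · cases j with
        | zero => simp
        | succ j =>
          rw [if_pos (by omega), ih _ _ _ (by omega)]
          simp
      · cases i with
        | zero => simp
        | succ i =>
          rw [if_pos (by omega), ih _ _ _ (by omega)]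
          simp
    · split_ifs with h'
      · rw [ih _ _ _ h']
        simp
      · symm
        refine Eq.trans ?_ (unshuffleSum₃_zero deg (List.ofFn fun a => z a.succ))
        refine unshuffleSum₃_congr fun A B C hlen => ?_
        rw [List.length_ofFn] at hlen
        rw [if_neg (by omega), smul_zero]

theorem sum_shuffles₃ {n : ℕ} (z : Fin n → P) (j i : ℕ) (h : j + i ≤ n)
    (F : List P → List P → List P → N) :
    ∑ σ ∈ shuffles₃ n j i, koszulSign (fun a => deg (z a)) σ •
        evalBlocks F j i (List.ofFn fun a => z (σ a)) =
      unshuffleSum₃ deg (List.ofFn z)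
        (fun A B C => if A.length = j ∧ B.length = i then F A B C else 0) := by
  rw [← shuffleSum₃_eq deg z j i h, shuffleSum₃, Finset.sum_ite_mem, Finset.univ_inter]

/-- Two-block shuffles are three-block shuffles with an empty first block. -/
theorem shuffles₂_eq_shuffles₃ (n i : ℕ) : shuffles₂ n i = shuffles₃ n 0 i := by
  ext σ
  simp [shuffles₂, shuffles₃]

theorem sum_shuffles₂ {n : ℕ} (z : Fin n → P) (i : ℕ) (h : i ≤ n) (F : List P → List P → N) :
    ∑ σ ∈ shuffles₂ n i, koszulSign (fun a => deg (z a)) σ •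
        F ((List.ofFn fun a => z (σ a)).take i) ((List.ofFn fun a => z (σ a)).drop i) =
      unshuffleSum deg (List.ofFn z) (fun A B => if A.length = i then F A B else 0) := by
  have := sum_shuffles₃ deg z 0 i (by omega) (fun _ B C => F B C)
  simp only [evalBlocks, List.drop_zero, zero_add] at this
  rw [shuffles₂_eq_shuffles₃, this, unshuffleSum₃]
  refine unshuffleSum_congr fun D C _ _ => ?_
  rw [← unshuffleSum_ite_nil deg D (fun B => if B.length = i then F B C else 0)]
  simp only [ite_and]

theorem sum_range_sum_shuffles₂ {n : ℕ} (z : Fin n → P) (F : List P → List P → N) :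
    ∑ i ∈ Finset.range (n + 1), ∑ σ ∈ shuffles₂ n i, koszulSign (fun a => deg (z a)) σ •
        F ((List.ofFn fun a => z (σ a)).take i) ((List.ofFn fun a => z (σ a)).drop i) =
      unshuffleSum deg (List.ofFn z) F := by
  rw [Finset.sum_congr rfl fun i hi =>
    sum_shuffles₂ deg z i (Nat.lt_succ_iff.1 (Finset.mem_range.1 hi)) F, ← unshuffleSum_sum]
  refine unshuffleSum_congr fun A B h _ => ?_
  rw [List.length_ofFn] at h
  rw [Finset.sum_ite_eq, if_pos (Finset.mem_range.2 (by omega))]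

theorem sum_range_sum_shuffles₃ {n : ℕ} (z : Fin n → P) (F : List P → List P → List P → N)
    (hF : ∀ A C, F A [] C = 0) :
    ∑ j ∈ Finset.range n, ∑ i ∈ Finset.Icc 1 (n - j), ∑ σ ∈ shuffles₃ n j i,
        koszulSign (fun a => deg (z a)) σ • evalBlocks F j i (List.ofFn fun a => z (σ a)) =
      unshuffleSum₃ deg (List.ofFn z) F := by
  have h1 : ∀ j ∈ Finset.range n, ∀ i ∈ Finset.Icc 1 (n - j), j + i ≤ n := by
    intro j hj i hi
    rw [Finset.mem_range] at hj
    rw [Finset.mem_Icc] at hi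
    omega
  rw [Finset.sum_congr rfl fun j hj => Finset.sum_congr rfl fun i hi =>
    sum_shuffles₃ deg z j i (h1 j hj i hi) F]
  simp only [← unshuffleSum₃_sum]
  refine unshuffleSum₃_congr fun A B C h => ?_
  rw [List.length_ofFn] at h
  cases B with
  | nil => simp [hF]
  | cons b B =>
    rw [List.length_cons] at h
    rw [Finset.sum_eq_single A.length, Finset.sum_eq_single (b :: B).length]
    · simp
    · intro i _ hi
      rw [if_neg fun hc => hi hc.2.symm]
    · intro hi
      rw [Finset.mem_Icc, List.length_cons] at hi
      omega
    · intro j _ hj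
      exact Finset.sum_eq_zero fun i _ => if_neg fun hc => hj hc.1.symm
    · intro hj
      rw [Finset.mem_range] at hj
      omega

end Bridge

/-! ### Graded symmetry: adjacent exchanges and arbitrary permutations -/

section Symmetry

variable {P : Type*} {deg : P → ℤ} {N : Type*} [AddCommGroup N]

theorem IsSwapSymmetric.move_front {f : List P → N} (hf : IsSwapSymmetric deg f)
    (A B : List P) (x : P) :
    f (A ++ x :: B) = Int.negOnePow (deg x * degSum deg A) • f (x :: (A ++ B)) := by
  induction A generalizing f with
  | nil => simp
  | cons a A ih =>
    have h := hf [] a x (A ++ B)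
    simp only [List.nil_append] at h
    rw [List.cons_append, ih (hf.cons a), h, smul_smul, List.cons_append, degSum_cons, mul_add,
      Int.negOnePow_add, mul_comm (deg a), mul_comm (Int.negOnePow _)]

/-- Symmetry under adjacent exchanges implies symmetry under all permutations. -/
theorem IsSwapSymmetric.comp_perm {n : ℕ} {f : List P → N} (hf : IsSwapSymmetric deg f)
    (z : Fin n → P) (σ : Equiv.Perm (Fin n)) :
    f (List.ofFn fun a => z (σ a)) = koszulSign (fun a => deg (z a)) σ • f (List.ofFn z) := by
  induction n generalizing f with
  | zero => simp [koszulSign]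
  | succ n ih =>
    obtain ⟨p, τ, rfl⟩ := exists_eq_insertZero σ
    rw [ofFn_comp_insertZero, hf.move_front, List.take_append_drop, koszulSign_insertZero,
      ih (hf.cons (z 0)) (fun a => z a.succ) τ, smul_smul, List.ofFn_succ (f := z)]

/-- An exchange of two adjacent entries is a permutation with the expected Koszul sign. -/
theorem exists_perm_swap {n : ℕ} (z : Fin n → P) (A : List P) (x y : P) (B : List P)
    (h : List.ofFn z = A ++ x :: y :: B) :
    ∃ σ : Equiv.Perm (Fin n), (List.ofFn fun a => z (σ a)) = A ++ y :: x :: B ∧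
      koszulSign (fun a => deg (z a)) σ = Int.negOnePow (deg x * deg y) := by
  induction A generalizing n with
  | nil =>
    obtain ⟨m, rfl⟩ : ∃ m, n = m + 2 := by
      have := congrArg List.length h
      simp at this
      exact ⟨B.length, this⟩
    simp only [List.ofFn_succ, List.nil_append, List.cons.injEq] at h
    obtain ⟨rfl, rfl, rfl⟩ := h
    refine ⟨insertZero 1 1, ?_, ?_⟩
    · rw [ofFn_comp_insertZero]
      simp [List.ofFn_succ]
    · rw [koszulSign_insertZero]
      have : koszulSign (fun a => deg (z a.succ)) 1 = 1 := by
        refine Finset.prod_eq_one fun a _ => Finset.prod_eq_one fun b _ => if_neg ?_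
        rintro ⟨h1, h2⟩
        exact lt_asymm h1 h2
      rw [this]
      simp [List.ofFn_succ]
  | cons a A ih =>
    obtain ⟨m, rfl⟩ : ∃ m, n = m + 1 := by
      have := congrArg List.length h
      simp at this
      exact ⟨_, this⟩
    rw [List.ofFn_succ, List.cons_append, List.cons.injEq] at h
    obtain ⟨σ, h1, h2⟩ := ih _ h.2
    refine ⟨insertZero 0 σ, ?_, ?_⟩
    · rw [ofFn_comp_insertZero, h1, h.1]
      simp
    · rw [koszulSign_insertZero, h2]
      simp

theorem IsSwapSymmetric.of_comp_perm {f : List P → N}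
    (h : ∀ (n : ℕ) (z : Fin n → P) (σ : Equiv.Perm (Fin n)),
      f (List.ofFn fun a => z (σ a)) = koszulSign (fun a => deg (z a)) σ • f (List.ofFn z)) :
    IsSwapSymmetric deg f := by
  intro A x y B
  obtain ⟨σ, h1, h2⟩ := exists_perm_swap (deg := deg) (A ++ y :: x :: B).get A y x B
    (List.ofFn_get _)
  rw [← h1, h, h2, List.ofFn_get, mul_comm]

end Symmetry

/-! ### Structure maps evaluated at lists -/

section Lists

theorem ofFn_block {n : ℕ} {α : Type*} [Zero α] (x : Fin n → α) (s l : ℕ) (h : s + l ≤ n) :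
    List.ofFn (block x s l) = ((List.ofFn x).drop s).take l := by
  refine List.ext_getElem (by simp; omega) fun a h1 h2 => ?_
  rw [List.length_ofFn] at h1
  have : s + a < n := by omega
  simp [block, this]

variable {K : Type*} [Field K] {V : Type*} [AddCommGroup V] [Module K V] {𝒱 : ℤ → Submodule K V}

variable (𝒱) in
/-- Homogeneous elements of `V`, together with a degree. -/
abbrev Homog : Type _ := Σ k : ℤ, 𝒱 k

/-- The list of vectors underlying a list of homogeneous elements. -/
def vals (L : List (Homog 𝒱)) : List V := L.map fun p => (p.2 : V)

@[simp] theorem vals_nil : vals ([] : List (Homog 𝒱)) = [] := rfl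

@[simp] theorem vals_cons (p : Homog 𝒱) (L : List (Homog 𝒱)) :
    vals (p :: L) = (p.2 : V) :: vals L := rfl

theorem vals_ofFn {n : ℕ} (z : Fin n → Homog 𝒱) :
    vals (List.ofFn z) = List.ofFn fun a => ((z a).2 : V) := by
  simp [vals, List.map_ofFn, Function.comp_def]

variable (E : ∀ p q : ℕ, GSym 𝒱 p ⊗[K] GSym 𝒱 q →ₗ[K] V)

/-- `E p q (a₁ ⋯ a_p ⊗ b₁ ⋯ b_q)` for lists `A = [a₁, …, a_p]` and `B = [b₁, …, b_q]`. -/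
def evalLists (A B : List V) : V :=
  E A.length B.length (symProd 𝒱 A.length A.get ⊗ₜ[K] symProd 𝒱 B.length B.get)

theorem evalLists_ofFn {p q : ℕ} (x : Fin p → V) (y : Fin q → V) :
    E p q (symProd 𝒱 p x ⊗ₜ[K] symProd 𝒱 q y) = evalLists E (List.ofFn x) (List.ofFn y) := by
  have key : ∀ (A B : List V) (hA : A.length = p) (hB : B.length = q)
      (_ : ∀ a, A.get (Fin.cast hA.symm a) = x a) (_ : ∀ b, B.get (Fin.cast hB.symm b) = y b),
      E p q (symProd 𝒱 p x ⊗ₜ[K] symProd 𝒱 q y) = evalLists E A B := by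
    intro A B hA hB h1 h2
    subst hA hB
    obtain rfl : A.get = x := funext h1
    obtain rfl : B.get = y := funext h2
    rfl
  exact key _ _ List.length_ofFn List.length_ofFn (by simp) (by simp)

theorem evalLists_cons_left (v : V) (A B : List V) :
    evalLists E (v :: A) B = E (A.length + 1) B.length
      (symProd 𝒱 (A.length + 1) (Fin.cons v A.get) ⊗ₜ[K] symProd 𝒱 B.length B.get) := by
  rw [evalLists_ofFn, List.ofFn_cons, List.ofFn_get, List.ofFn_get]

theorem evalLists_cons_right (v : V) (A B : List V) :
    evalLists E A (v :: B) = E A.length (B.length + 1)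
      (symProd 𝒱 A.length A.get ⊗ₜ[K] symProd 𝒱 (B.length + 1) (Fin.cons v B.get)) := by
  rw [evalLists_ofFn, List.ofFn_cons, List.ofFn_get, List.ofFn_get]

/-- `evalLists` as an additive function of the first entry of the first list. -/
def evalConsLeft (A B : List V) : V →+ V :=
  AddMonoidHom.mk' (fun v => evalLists E (v :: A) B) fun v w => by
    simp only [evalLists_cons_left, MultilinearMap.cons_add, TensorProduct.add_tmul, map_add]

/-- `evalLists` as an additive function of the first entry of the second list. -/
def evalConsRight (A B : List V) : V →+ V :=
  AddMonoidHom.mk' (fun v => evalLists E A (v :: B)) fun v w => by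
    simp only [evalLists_cons_right, MultilinearMap.cons_add, TensorProduct.tmul_add, map_add]

theorem evalLists_unshuffleSum_cons {P : Type*} {deg : P → ℤ} (L : List P)
    (f : List P → List P → V) (A B : List V) :
    evalLists E (unshuffleSum deg L f :: A) B =
      unshuffleSum deg L fun J I => evalLists E (f J I :: A) B :=
  map_unshuffleSum (evalConsLeft E A B) L f

theorem evalLists_cons_unshuffleSum {P : Type*} {deg : P → ℤ} (L : List P)
    (f : List P → List P → V) (A B : List V) :
    evalLists E A (unshuffleSum deg L f :: B) =
      unshuffleSum deg L fun J I => evalLists E A (f J I :: B) :=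
  map_unshuffleSum (evalConsRight E A B) L f

@[simp] theorem evalLists_zero_cons (A B : List V) : evalLists E (0 :: A) B = 0 :=
  map_zero (evalConsLeft E A B)

@[simp] theorem evalLists_cons_zero (A B : List V) : evalLists E A (0 :: B) = 0 :=
  map_zero (evalConsRight E A B)

/-- Graded commutativity of the product in `Symⁿ(V)`. -/
theorem symProd_comp_perm {n : ℕ} (z : Fin n → Homog 𝒱) (σ : Equiv.Perm (Fin n)) :
    symProd 𝒱 n (fun a => ((z (σ a)).2 : V)) =
      koszulSign (fun a => (z a).1) σ • symProd 𝒱 n (fun a => ((z a).2 : V)) := by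
  have h : symProd 𝒱 n (fun a => ((z a).2 : V)) =
      koszulSign (fun a => (z a).1) σ • symProd 𝒱 n (fun a => ((z (σ a)).2 : V)) := by
    rw [symProd, LinearMap.compMultilinearMap_apply, LinearMap.compMultilinearMap_apply,
      Units.smul_def, ← map_zsmul, ← sub_eq_zero, ← map_sub, Submodule.mkQ_apply,
      Submodule.Quotient.mk_eq_zero]
    exact Submodule.subset_span ⟨fun a => (z a).1, fun a => (z a).2, σ, fun a => (z a).2.2, rfl⟩
  rw [h, smul_smul, Int.units_mul_self, one_smul]

theorem isSwapSymmetric_evalLists_left (B : List V) :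
    IsSwapSymmetric Sigma.fst (fun A : List (Homog 𝒱) => evalLists E (vals A) B) := by
  refine IsSwapSymmetric.of_comp_perm fun n z σ => ?_
  rw [← List.ofFn_get B, vals_ofFn, vals_ofFn, ← evalLists_ofFn, ← evalLists_ofFn,
    symProd_comp_perm]
  rcases Int.units_eq_one_or (koszulSign (fun a => (z a).1) σ) with h | h <;>
    simp [h, TensorProduct.neg_tmul]

theorem isSwapSymmetric_evalLists_right (B : List V) :
    IsSwapSymmetric Sigma.fst (fun A : List (Homog 𝒱) => evalLists E B (vals A)) := by
  refine IsSwapSymmetric.of_comp_perm fun n z σ => ?_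
  rw [← List.ofFn_get B, vals_ofFn, vals_ofFn, ← evalLists_ofFn, ← evalLists_ofFn,
    symProd_comp_perm]
  rcases Int.units_eq_one_or (koszulSign (fun a => (z a).1) σ) with h | h <;>
    simp [h, TensorProduct.tmul_neg]

/-- The sub-adjacent bracket of a list of homogeneous elements. -/
def bracket (L : List (Homog 𝒱)) : V :=
  unshuffleSum Sigma.fst L fun A B => evalLists E (vals A) (vals B)

theorem bracket_cons_of_eq_zero {p : Homog 𝒱} (hp : (p.2 : V) = 0) (L : List (Homog 𝒱)) :
    bracket E (p :: L) = 0 := by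
  simp [bracket, unshuffleSum, hp]

theorem isSwapSymmetric_bracket : IsSwapSymmetric Sigma.fst (bracket E) :=
  IsSwapSymmetric.unshuffleSum (fun B => isSwapSymmetric_evalLists_left E (vals B))
    (fun A => isSwapSymmetric_evalLists_right E (vals A))

end Lists

/-! ### The identities for lists -/

section Identities

variable {K : Type*} [Field K] {V : Type*} [AddCommGroup V] [Module K V] {𝒱 : ℤ → Submodule K V}
  (E : ∀ p q : ℕ, GSym 𝒱 p ⊗[K] GSym 𝒱 q →ₗ[K] V)

/-- The second half of the post-Lie`∞` identity: an inner operation inserted into the second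
group of arguments. -/
def rightInsertion (C D : List (Homog 𝒱)) : V :=
  unshuffleSum Sigma.fst C fun A J => unshuffleSum Sigma.fst D fun I B =>
    Int.negOnePow (degSum Sigma.fst A) •
      evalLists E (vals A) (evalLists E (vals J) (vals I) :: vals B)

/-- The quadratic expression in the arguments `C ⊗ D` whose vanishing is the post-Lie`∞`
identity. -/
def postLieExpr (C D : List (Homog 𝒱)) : V :=
  unshuffleSum₃ Sigma.fst C (fun J I A =>
    evalLists E (evalLists E (vals J) (vals I) :: vals A) (vals D)) + rightInsertion E C D

/-- The first half of the post-Lie`∞` identity is the insertion of the sub-adjacent bracket. -/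
theorem unshuffleSum₃_eq_bracket (C : List (Homog 𝒱)) (D : List V) :
    unshuffleSum₃ Sigma.fst C (fun J I A =>
      evalLists E (evalLists E (vals J) (vals I) :: vals A) D) =
    unshuffleSum Sigma.fst C (fun I A => evalLists E (bracket E I :: vals A) D) := by
  simp only [bracket, evalLists_unshuffleSum_cons]
  rfl

/-- The Jacobi identity for the sub-adjacent bracket. By the recursion for `unshuffleSum`, the
inner bracket enters either the first or the second group of arguments of the outer operation.
Coassociativity and cocommutativity collect both kinds of terms into post-Lie`∞` expressions,
one for each way to split the arguments in two groups. -/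
theorem unshuffleSum_bracket_bracket (L : List (Homog 𝒱)) (β : List (Homog 𝒱) → Homog 𝒱)
    (hdeg : ∀ I, (β I).1 = degSum Sigma.fst I + 1) (hβ : ∀ I, ((β I).2 : V) = bracket E I) :
    unshuffleSum Sigma.fst L (fun I R => bracket E (β I :: R)) =
      unshuffleSum Sigma.fst L (postLieExpr E) := by
  have h1 : unshuffleSum Sigma.fst L (fun I R => unshuffleSum Sigma.fst R fun A B =>
        evalLists E (bracket E I :: vals A) (vals B)) =
      unshuffleSum Sigma.fst L (fun C D => unshuffleSum₃ Sigma.fst C (fun J I A =>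
        evalLists E (evalLists E (vals J) (vals I) :: vals A) (vals D))) := by
    simp only [unshuffleSum₃_eq_bracket]
    rw [unshuffleSum_coassoc]
  have h2 : unshuffleSum Sigma.fst L (fun I R => unshuffleSum Sigma.fst R fun A B =>
        Int.negOnePow ((degSum Sigma.fst I + 1) * degSum Sigma.fst A) •
          evalLists E (vals A) (bracket E I :: vals B)) =
      unshuffleSum Sigma.fst L (rightInsertion E) := by
    rw [← unshuffleSum_coassoc]
    -- bring the inner bracket behind the first group of arguments of the outer operation
    have h3 : ∀ C B : List (Homog 𝒱), unshuffleSum Sigma.fst C (fun I A =>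
          Int.negOnePow ((degSum Sigma.fst I + 1) * degSum Sigma.fst A) •
            evalLists E (vals A) (bracket E I :: vals B)) =
        unshuffleSum Sigma.fst C (fun A' I => unshuffleSum Sigma.fst A' fun A J =>
          Int.negOnePow (degSum Sigma.fst A) •
            evalLists E (vals A) (evalLists E (vals J) (vals I) :: vals B)) := by
      intro C B
      rw [unshuffleSum_coassoc, unshuffleSum_cocomm]
      refine unshuffleSum_congr fun A I _ _ => ?_
      rw [smul_smul, ← smul_unshuffleSum, ← evalLists_cons_unshuffleSum, ← bracket, add_mul,
        one_mul, Int.negOnePow_add, ← mul_assoc, negOnePow_mul_swap, one_mul]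
    simp only [h3]
    rw [unshuffleSum_coassoc]
    refine unshuffleSum_congr fun C D _ _ => ?_
    rw [rightInsertion, unshuffleSum_comm]
  calc _ = unshuffleSum Sigma.fst L (fun I R => unshuffleSum Sigma.fst R (fun A B =>
          evalLists E (bracket E I :: vals A) (vals B)) + unshuffleSum Sigma.fst R fun A B =>
        Int.negOnePow ((degSum Sigma.fst I + 1) * degSum Sigma.fst A) •
          evalLists E (vals A) (bracket E I :: vals B)) := by
        refine unshuffleSum_congr fun I R _ _ => ?_
        rw [bracket, unshuffleSum]
        simp only [vals_cons, hdeg, hβ]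
    _ = _ := by
        rw [unshuffleSum_add, h1, h2, ← unshuffleSum_add]
        rfl

end Identities

/-! ### The sub-adjacent structure of a post-Lie`∞` algebra -/

section SubadjacentStructure

variable {K : Type*} [Field K] {V : Type*} [AddCommGroup V] [Module K V] {𝒱 : ℤ → Submodule K V}
  (M : ∀ p q : ℕ, GSym 𝒱 p ⊗[K] GSym 𝒱 q →ₗ[K] V)

theorem extendByZero_of_pos (p : ℕ) {q : ℕ} (hq : 1 ≤ q) : extendByZero M p q = M p q := by
  cases q with
  | zero => omega
  | succ q => rfl

@[simp] theorem evalLists_extendByZero_nil (A : List V) :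
    evalLists (extendByZero M) A [] = 0 := rfl

theorem bracket_extendByZero_nil : bracket (extendByZero M) ([] : List (Homog 𝒱)) = 0 := rfl

theorem subadjacent_apply [DirectSum.Decomposition 𝒱] (k : ℕ) (d : Fin k → ℤ) (x : Fin k → V)
    (hx : ∀ a, x a ∈ 𝒱 (d a)) :
    subadjacent M k x = ∑ j ∈ Finset.range k, ∑ σ ∈ shuffles₂ k j, koszulSign d σ •
      M j (k - j) (symProd 𝒱 j (block (x ∘ σ) 0 j) ⊗ₜ[K]
        symProd 𝒱 (k - j) (block (x ∘ σ) j (k - j))) := by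
  have hdec : ∀ a, DirectSum.decomposeLinearEquiv 𝒱 (x a) =
      DirectSum.lof K ℤ (fun c => 𝒱 c) (d a) ⟨x a, hx a⟩ := fun a =>
    DirectSum.decompose_of_mem 𝒱 (hx a)
  rw [subadjacent, MultilinearMap.compLinearMap_apply]
  simp only [LinearEquiv.coe_coe, hdec]
  rw [MultilinearMap.fromDirectSumEquiv_lof, MultilinearMap.compLinearMap_apply, subadjacentAt,
    sum_apply, Finset.sum_range]
  refine Finset.sum_congr rfl fun j _ => ?_
  rw [sum_apply]
  refine Finset.sum_congr rfl fun σ _ => ?_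
  rw [Units.smul_def, smul_apply, MultilinearMap.domDomCongr_apply,
    splitEval_apply, Units.smul_def]
  rfl

variable {M}

theorem sum_block_eq_degSum {n : ℕ} (z : Fin n → Homog 𝒱) (σ : Equiv.Perm (Fin n)) (i : ℕ)
    (hi : i ≤ n) : ∑ a : Fin i, block ((fun a => (z a).1) ∘ σ) 0 i a =
      degSum Sigma.fst ((List.ofFn fun a => z (σ a)).take i) := by
  rw [← List.sum_ofFn, ofFn_block _ _ _ (by omega), List.drop_zero, degSum, List.map_take,
    List.map_ofFn]
  rfl

theorem ofFn_block_comp {n : ℕ} (z : Fin n → Homog 𝒱) (σ : Equiv.Perm (Fin n)) (s l : ℕ)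
    (h : s + l ≤ n) : List.ofFn (block ((fun a => ((z a).2 : V)) ∘ σ) s l) =
      vals (((List.ofFn fun a => z (σ a)).drop s).take l) := by
  rw [ofFn_block _ _ _ h, vals, List.map_take, List.map_drop, List.map_ofFn]
  rfl

theorem ofFn_block_comp_last {n : ℕ} (z : Fin n → Homog 𝒱) (σ : Equiv.Perm (Fin n)) (s l : ℕ)
    (h : s + l = n) : List.ofFn (block ((fun a => ((z a).2 : V)) ∘ σ) s l) =
      vals ((List.ofFn fun a => z (σ a)).drop s) := by
  rw [ofFn_block_comp z σ s l h.le, List.take_of_length_le]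
  rw [List.length_drop, List.length_ofFn]
  omega

theorem ofFn_block_comp_first {n : ℕ} (z : Fin n → Homog 𝒱) (σ : Equiv.Perm (Fin n)) (l : ℕ)
    (h : l ≤ n) : List.ofFn (block ((fun a => ((z a).2 : V)) ∘ σ) 0 l) =
      vals ((List.ofFn fun a => z (σ a)).take l) := by
  rw [ofFn_block_comp z σ 0 l (by omega), List.drop_zero]

theorem subadjacent_eq_bracket [DirectSum.Decomposition 𝒱] {k : ℕ} (z : Fin k → Homog 𝒱) :
    subadjacent M k (fun a => ((z a).2 : V)) = bracket (extendByZero M) (List.ofFn z) := by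
  rw [subadjacent_apply M k (fun a => (z a).1) _ fun a => (z a).2.2, bracket,
    ← sum_range_sum_shuffles₂, Finset.sum_range_succ]
  have h0 : ∀ σ : Equiv.Perm (Fin k), (List.ofFn fun a => z (σ a)).drop k = [] := fun σ =>
    List.drop_of_length_le (by rw [List.length_ofFn])
  simp only [h0, vals_nil, evalLists_extendByZero_nil, smul_zero, Finset.sum_const_zero, add_zero]
  refine Finset.sum_congr rfl fun j hj => Finset.sum_congr rfl fun σ _ => ?_
  rw [Finset.mem_range] at hj
  rw [← extendByZero_of_pos M j (by omega), evalLists_ofFn, ofFn_block_comp_first _ _ _ hj.le,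
    ofFn_block_comp_last _ _ _ _ (by omega)]

theorem subadjacent_eq_bracket' [DirectSum.Decomposition 𝒱] {k : ℕ} (y : Fin k → V)
    (L : List (Homog 𝒱)) (h : List.ofFn y = vals L) :
    subadjacent M k y = bracket (extendByZero M) L := by
  have hk : L.length = k := by simpa [vals] using (congrArg List.length h).symm
  subst hk
  have hy : y = fun a => ((L.get a).2 : V) := by
    rw [← List.ofFn_inj, h, ← vals_ofFn, List.ofFn_get]
  rw [hy, subadjacent_eq_bracket, List.ofFn_get]

/-- The double sum over shuffles that occurs in the post-Lie`∞` identity and in the compatibility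
condition of open-closed homotopy Lie algebras, with all empty groups of arguments admitted. -/
theorem sum_shuffles_eq_rightInsertion (E : ∀ p q : ℕ, GSym 𝒱 p ⊗[K] GSym 𝒱 q →ₗ[K] V)
    {n m : ℕ} (z : Fin n → Homog 𝒱) (w : Fin m → Homog 𝒱) :
    ∑ i ∈ Finset.range (n + 1), ∑ k ∈ Finset.range (m + 1),
      ∑ σ ∈ shuffles₂ n i, ∑ τ ∈ shuffles₂ m k,
        (koszulSign (fun a => (z a).1) σ * koszulSign (fun b => (w b).1) τ *
          Int.negOnePow (degSum Sigma.fst ((List.ofFn fun a => z (σ a)).take i))) •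
        evalLists E (vals ((List.ofFn fun a => z (σ a)).take i))
          (evalLists E (vals ((List.ofFn fun a => z (σ a)).drop i))
              (vals ((List.ofFn fun b => w (τ b)).take k)) ::
            vals ((List.ofFn fun b => w (τ b)).drop k)) =
      rightInsertion E (List.ofFn z) (List.ofFn w) := by
  rw [rightInsertion, ← sum_range_sum_shuffles₂]
  refine Finset.sum_congr rfl fun i _ => ?_
  rw [Finset.sum_comm]
  refine Finset.sum_congr rfl fun σ _ => ?_
  rw [← sum_range_sum_shuffles₂, Finset.smul_sum]
  refine Finset.sum_congr rfl fun k _ => ?_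
  rw [Finset.smul_sum]
  refine Finset.sum_congr rfl fun τ _ => ?_
  rw [smul_smul, smul_smul, mul_assoc]

theorem exists_homog {n : ℕ} {d : Fin n → ℤ} {x : Fin n → V} (hx : ∀ a, x a ∈ 𝒱 (d a)) :
    ∃ z : Fin n → Homog 𝒱, d = (fun a => (z a).1) ∧ x = fun a => ((z a).2 : V) :=
  ⟨fun a => ⟨d a, x a, hx a⟩, rfl, rfl⟩

theorem sum_Icc_one_eq_sum_range {N : Type*} [AddCommMonoid N] {n : ℕ} {f g : ℕ → N}
    (hfg : ∀ i, 1 ≤ i → i ≤ n → f i = g i) (hg : g 0 = 0) :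
    ∑ i ∈ Finset.Icc 1 n, f i = ∑ i ∈ Finset.range (n + 1), g i := by
  refine (Finset.sum_congr rfl fun i hi => ?_).trans
    (Finset.sum_subset (s₁ := Finset.Icc 1 n) ?_ ?_)
  · rw [Finset.mem_Icc] at hi
    exact hfg i hi.1 hi.2
  · intro i hi
    rw [Finset.mem_Icc] at hi
    rw [Finset.mem_range]
    omega
  · intro i hi hi'
    rw [Finset.mem_range] at hi
    rw [Finset.mem_Icc] at hi'
    obtain rfl : i = 0 := by omega
    exact hg

/-- The post-Lie`∞` identity for lists. With `M p 0 = 0` it needs no restriction on the lengths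
of the lists, and it holds trivially if `D` is empty. -/
theorem IsPostLieInfinity.postLieExpr_eq_zero (hM : IsPostLieInfinity 𝒱 M)
    (C D : List (Homog 𝒱)) : postLieExpr (extendByZero M) C D = 0 := by
  rcases Nat.eq_zero_or_pos D.length with hD | hD
  · rw [List.length_eq_zero_iff] at hD
    subst hD
    simp [postLieExpr, rightInsertion, unshuffleSum]
  · obtain ⟨n, z, rfl⟩ : ∃ (n : ℕ) (z : Fin n → Homog 𝒱), C = List.ofFn z :=
      ⟨_, C.get, (List.ofFn_get C).symm⟩
    obtain ⟨m, w, rfl⟩ : ∃ (m : ℕ) (w : Fin m → Homog 𝒱), D = List.ofFn w :=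
      ⟨_, D.get, (List.ofFn_get D).symm⟩
    rw [List.length_ofFn] at hD
    have h := hM.maurerCartan n m hD (fun a => (z a).1) (fun a => (z a).2) (fun b => (w b).1)
      (fun b => (w b).2) (fun a => (z a).2.2) (fun b => (w b).2.2)
    rw [postLieExpr, ← sum_range_sum_shuffles₃ _ z _ fun A B => by simp,
      ← sum_shuffles_eq_rightInsertion, ← h]
    congr 1
    · refine Finset.sum_congr rfl fun j hj => Finset.sum_congr rfl fun i hi =>
        Finset.sum_congr rfl fun σ _ => ?_
      rw [Finset.mem_range] at hj
      rw [Finset.mem_Icc] at hi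
      rw [← extendByZero_of_pos M _ hD, ← extendByZero_of_pos M _ hi.1, evalLists_ofFn,
        evalLists_ofFn, List.ofFn_cons, ofFn_block_comp_first _ _ _ (by omega),
        ofFn_block_comp _ _ _ _ (by omega), ofFn_block_comp_last _ _ _ _ (by omega),
        ← vals_ofFn, evalBlocks]
    · -- the post-Lie`∞` identity indexes this sum by the length `n - i` of the second block
      rw [← Finset.sum_flip]
      refine Finset.sum_congr rfl fun j hj => ?_
      rw [Finset.mem_range] at hj
      symm
      refine sum_Icc_one_eq_sum_range (fun i hi hi' => Finset.sum_congr rfl fun σ _ =>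
        Finset.sum_congr rfl fun τ _ => ?_) (by simp)
      rw [← extendByZero_of_pos M _ (Nat.le_add_left 1 (m - i)), ← extendByZero_of_pos M _ hi,
        evalLists_ofFn, evalLists_ofFn, List.ofFn_cons,
        ofFn_block_comp_first _ _ _ (by omega), ofFn_block_comp_first _ _ _ hi',
        ofFn_block_comp_last _ _ _ _ (by omega), ofFn_block_comp_last _ _ _ _ (by omega),
        sum_block_eq_degSum _ _ _ (by omega)]

theorem IsPostLieInfinity.evalLists_mem (hM : IsPostLieInfinity 𝒱 M) (A B : List (Homog 𝒱)) :
    evalLists (extendByZero M) (vals A) (vals B) ∈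
      𝒱 (degSum Sigma.fst A + degSum Sigma.fst B + 1) := by
  cases B with
  | nil => simp
  | cons b B =>
    have h := hM.degree_one A.length (b :: B).length (by simp) (fun a => (A.get a).1)
      (fun a => (A.get a).2) (fun a => ((b :: B).get a).1) (fun a => ((b :: B).get a).2)
      (fun a => (A.get a).2.2) (fun a => ((b :: B).get a).2.2)
    rw [← extendByZero_of_pos M _ (by simp), evalLists_ofFn, ← vals_ofFn, ← vals_ofFn,
      List.ofFn_get, List.ofFn_get, ← List.sum_ofFn, ← List.sum_ofFn] at h
    have hdeg : ∀ L : List (Homog 𝒱), (List.ofFn fun a => (L.get a).1).sum =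
        degSum Sigma.fst L := fun L => by
      rw [degSum]
      conv_rhs => rw [← List.ofFn_get L, List.map_ofFn]
      rfl
    rwa [hdeg, hdeg] at h

theorem IsPostLieInfinity.bracket_mem (hM : IsPostLieInfinity 𝒱 M) (L : List (Homog 𝒱)) :
    bracket (extendByZero M) L ∈ 𝒱 (degSum Sigma.fst L + 1) := by
  refine unshuffleSum_mem (S := (𝒱 (degSum Sigma.fst L + 1)).toAddSubgroup) fun A B h => ?_
  rw [← h]
  exact hM.evalLists_mem A B

/-- The sub-adjacent bracket as a homogeneous element. -/
def IsPostLieInfinity.bracketHomog (hM : IsPostLieInfinity 𝒱 M) (L : List (Homog 𝒱)) :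
    Homog 𝒱 :=
  ⟨degSum Sigma.fst L + 1, bracket (extendByZero M) L, hM.bracket_mem L⟩

theorem IsPostLieInfinity.isLInfinityAlgebra [DirectSum.Decomposition 𝒱]
    (hM : IsPostLieInfinity 𝒱 M) : IsLInfinityAlgebra 𝒱 (subadjacent M) where
  degree_one k _ d x hx := by
    have h := hM.bracket_mem (List.ofFn fun a => (⟨d a, x a, hx a⟩ : Homog 𝒱))
    rw [← subadjacent_eq_bracket, degSum, List.map_ofFn, List.sum_ofFn] at h
    exact h
  symmetric k _ d x hx σ := by
    have h := (isSwapSymmetric_bracket (extendByZero M)).comp_perm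
      (fun a => (⟨d a, x a, hx a⟩ : Homog 𝒱)) σ
    rw [← subadjacent_eq_bracket, ← subadjacent_eq_bracket] at h
    exact h
  jacobi n d x hx := by
    obtain ⟨z, rfl, rfl⟩ := exists_homog hx
    have h := unshuffleSum_bracket_bracket (extendByZero M) (List.ofFn z) hM.bracketHomog
      (fun _ => rfl) (fun _ => rfl)
    rw [unshuffleSum_congr fun C D _ _ => hM.postLieExpr_eq_zero C D, unshuffleSum_zero,
      ← sum_range_sum_shuffles₂] at h
    rw [← h]
    refine sum_Icc_one_eq_sum_range (fun i _ hi => Finset.sum_congr rfl fun σ _ => ?_) ?_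
    · rw [subadjacent_eq_bracket' _ _ (ofFn_block_comp_first z σ i hi)]
      congr 1
      refine subadjacent_eq_bracket' _ _ ?_
      rw [List.ofFn_cons, vals_cons, ofFn_block_comp_last z σ _ _ (by omega)]
      rfl
    · refine Finset.sum_eq_zero fun σ _ => ?_
      rw [List.take_zero, bracket_cons_of_eq_zero _ (bracket_extendByZero_nil M), smul_zero]

theorem IsPostLieInfinity.isOpenClosedHomotopyLie [DirectSum.Decomposition 𝒱]
    (hM : IsPostLieInfinity 𝒱 M) :
    IsOpenClosedHomotopyLie 𝒱 𝒱 (subadjacent M) (extendByZero M) where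
  isLInfinity := hM.isLInfinityAlgebra
  degree_one p q _ d x e u hx hu := by
    cases q with
    | zero => exact zero_mem _
    | succ q => exact hM.degree_one p (q + 1) (by omega) d x e u hx hu
  compat n m _ d x e u hx hu := by
    obtain ⟨z, rfl, rfl⟩ := exists_homog hx
    obtain ⟨w, rfl, rfl⟩ := exists_homog hu
    rw [← hM.postLieExpr_eq_zero (List.ofFn z) (List.ofFn w), postLieExpr,
      unshuffleSum₃_eq_bracket, ← sum_range_sum_shuffles₂, ← sum_shuffles_eq_rightInsertion]
    congr 1
    · refine sum_Icc_one_eq_sum_range (fun i _ hi => Finset.sum_congr rfl fun σ _ => ?_)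
        (by simp [bracket_extendByZero_nil])
      rw [subadjacent_eq_bracket' _ _ (ofFn_block_comp_first z σ i hi), evalLists_ofFn,
        List.ofFn_cons, vals_ofFn, ofFn_block_comp_last z σ i _ (by omega)]
    · refine Finset.sum_congr rfl fun i hi => ?_
      rw [Finset.mem_range] at hi
      rw [Finset.sum_filter_of_ne]
      · refine Finset.sum_congr rfl fun k hk => Finset.sum_congr rfl fun σ _ =>
          Finset.sum_congr rfl fun τ _ => ?_
        rw [Finset.mem_range] at hk
        rw [evalLists_ofFn, evalLists_ofFn, List.ofFn_cons,
          ofFn_block_comp_first z _ _ (by omega), ofFn_block_comp_first w _ _ (by omega),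
          ofFn_block_comp_last z _ _ _ (by omega), ofFn_block_comp_last w _ _ _ (by omega),
          sum_block_eq_degSum _ _ _ (by omega)]
      · -- the terms with `k = 0` vanish
        intro k _ hk
        contrapose! hk
        obtain rfl : k = 0 := by omega
        refine Finset.sum_eq_zero fun σ _ => Finset.sum_eq_zero fun τ _ => ?_
        rw [evalLists_ofFn, evalLists_ofFn, List.ofFn_cons]
        simp

end SubadjacentStructure

end PostLieInfinity

/-- Let `M` be a post-Lie`∞` algebra structure on a graded vector space `V`. The brackets
`subadjacent M k` are given on homogeneous elements by the shuffle formula, they form an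
`L∞`-algebra structure on `V`, and together with `M` (completed by `M p 0 = 0`) they form an
open-closed homotopy Lie algebra on `(V, V)`. -/
theorem mainTheorem5 {K : Type*} [Field K] [CharZero K] {V : Type*} [AddCommGroup V] [Module K V]
    (𝒱 : ℤ → Submodule K V) [DirectSum.Decomposition 𝒱]
    (M : ∀ p q : ℕ, PostLieInfinity.GSym 𝒱 p ⊗[K] PostLieInfinity.GSym 𝒱 q →ₗ[K] V)
    (hM : PostLieInfinity.IsPostLieInfinity 𝒱 M) :
    (∀ (k : ℕ) (d : Fin k → ℤ) (x : Fin k → V), (∀ a, x a ∈ 𝒱 (d a)) →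
      PostLieInfinity.subadjacent M k x =
        ∑ j ∈ Finset.range k, ∑ σ ∈ PostLieInfinity.shuffles₂ k j,
          PostLieInfinity.koszulSign d σ •
            M j (k - j)
              (PostLieInfinity.symProd 𝒱 j (PostLieInfinity.block (x ∘ σ) 0 j)
                ⊗ₜ[K] PostLieInfinity.symProd 𝒱 (k - j)
                  (PostLieInfinity.block (x ∘ σ) j (k - j)))) ∧
    PostLieInfinity.IsLInfinityAlgebra 𝒱 (PostLieInfinity.subadjacent M) ∧
    PostLieInfinity.IsOpenClosedHomotopyLie 𝒱 𝒱 (PostLieInfinity.subadjacent M)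
      (PostLieInfinity.extendByZero M) ∧
    (∀ p : ℕ, 1 ≤ p → PostLieInfinity.extendByZero M p 0 = 0) := by
  exact ⟨PostLieInfinity.subadjacent_apply M, hM.isLInfinityAlgebra,
    hM.isOpenClosedHomotopyLie, fun _ _ => rfl⟩
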